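/- Let $Y\subset\mathbb{R}^n$ be a Lebesgue measurable set of finite positive Lebesgue measure $\lambda_n(Y)$, and let $u^{\#}:Y\to\mathbb{R}^n$ be integrable and equal almost everywhere in $Y$ to the gradient $\nabla\psi$ of a proper lower semicontinuous convex function $\psi:\mathbb{R}^n\to\overline{\mathbb{R}}$. Suppose that $u^{\#}$, restricted to the complement $Y_0$ in $Y$ of its level sets of positive measure, is not almost injective; that is, there is no set $U\subset Y_0$ with $\lambda_n(Y_0\setminus U)=0$ on which $u^{\#}$ is injective. Let $(X,\mu)$ be a measure-interval (a finite complete measure space that is isomorphic, up to sets of measure zero, to $[0,\mu(X)]$ with Lebesgue measure on the Lebesgue sets) satisfying $\mu(X)=\lambda_n(Y)$. Let $u:X\to\mathbb{R}^n$ be a rearrangement of $u^{\#}$, i.e. $u$ is integrable and $\mu(u^{-1}(B))=\lambda_n((u^{\#})^{-1}(B))$ for every Borel set $B\subset\mathbb{R}^n$. Suppose that $u$ is almost countable to one on the complement $X_0$ of its level sets of positive measure; that is, there is a set $U\subset X_0$ with $\mu(X_0\setminus U)=0$ whose intersection with every level set of $u$ is countable. Then $u$ does not have a polar factorisation through $Y$: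 there are no integrable $v:Y\to\mathbb{R}^n$ and measure-preserving mapping $s:X\to Y$ (that is, $\mu(s^{-1}(A))=\lambda_n(A)$ for all Borel subsets $A$ of $Y$) such that $v$ is a rearrangement of $u$, $v$ is equal almost everywhere in $Y$ to the gradient of a proper lower semicontinuous convex function $\mathbb{R}^n\to\overline{\mathbb{R}}$, and $u=v\circ s$ almost everywhere. (Such a $v$, the monotone rearrangement of $u$ on $Y$, is unique up to equality almost everywhere, so here $v=u^{\#}$ almost everywhere.) -/

import Mathlib

open MeasureTheory Set Filter Topology

/-- Two vector-valued integrable functions on measure spaces of equal finite total mass are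
rearrangements of each other if the preimages of every Borel set have the same measure. -/
def IsRearrangement {n : ℕ} {X Z : Type*} [MeasurableSpace X] [MeasurableSpace Z]
    (f : X → EuclideanSpace ℝ (Fin n)) (μ : Measure X)
    (g : Z → EuclideanSpace ℝ (Fin n)) (ν : Measure Z) : Prop :=
  Integrable f μ ∧ Integrable g ν ∧
    ∀ B : Set (EuclideanSpace ℝ (Fin n)), MeasurableSet B → μ (f ⁻¹' B) = ν (g ⁻¹' B)

/-- A finite complete measure space is a measure-interval if it is isomorphic, up to sets of
measure zero, to the interval `[0, μ(X)]` with Lebesgue measure on the Lebesgue sets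
(the null-measurable sets of `volume`). -/
structure IsMeasureInterval {X : Type*} [MeasurableSpace X] (μ : Measure X) : Prop where
  finite : μ univ < ⊤
  complete : μ.IsComplete
  exists_transformation : ∃ τ : X → ℝ,
    (∀ x, τ x ∈ Icc (0 : ℝ) (μ univ).toReal) ∧
    (∀ B ⊆ Icc (0 : ℝ) (μ univ).toReal, NullMeasurableSet B volume →
      MeasurableSet (τ ⁻¹' B) ∧ μ (τ ⁻¹' B) = volume B) ∧
    ∃ (L : Set X) (M : Set ℝ), μ L = 0 ∧ volume M = 0 ∧
      BijOn τ Lᶜ (Icc (0 : ℝ) (μ univ).toReal \ M) ∧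
      ∀ A ⊆ Lᶜ, MeasurableSet A →
        NullMeasurableSet (τ '' A) volume ∧ volume (τ '' A) = μ A

/-- Proper lower semicontinuous convex functions with values in the extended reals; convexity
is convexity of the epigraph. -/
structure IsProperLscConvex {n : ℕ} (ψ : EuclideanSpace ℝ (Fin n) → EReal) : Prop where
  ne_bot : ∀ y, ψ y ≠ ⊥
  exists_ne_top : ∃ y, ψ y ≠ ⊤
  lsc : LowerSemicontinuous ψ
  convex : Convex ℝ {p : EuclideanSpace ℝ (Fin n) × ℝ | ψ p.1 ≤ (p.2 : EReal)}

/-- The extended-real-valued function `ψ` is finite near `y` and differentiable at `y`, with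
gradient `p`. -/
def HasExtGradientAt {n : ℕ} (ψ : EuclideanSpace ℝ (Fin n) → EReal)
    (p y : EuclideanSpace ℝ (Fin n)) : Prop :=
  (∀ᶠ z in 𝓝 y, ψ z ≠ ⊤ ∧ ψ z ≠ ⊥) ∧ HasGradientAt (fun z => (ψ z).toReal) p y

/-- On `Y` (with Lebesgue measure), the function `v` agrees almost everywhere with the gradient
of a proper lower semicontinuous convex function. A function on `Y` is represented
by a function on the whole space, whose values outside `Y` play no role. -/
def IsConvexGradientOn {n : ℕ} (v : EuclideanSpace ℝ (Fin n) → EuclideanSpace ℝ (Fin n))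
    (Y : Set (EuclideanSpace ℝ (Fin n))) : Prop :=
  ∃ ψ : EuclideanSpace ℝ (Fin n) → EReal, IsProperLscConvex ψ ∧
    ∀ᵐ y ∂(volume.restrict Y), HasExtGradientAt ψ (v y) y

/-- `v` is a (version of the) monotone rearrangement of `u` on `Y`. -/
def IsMonotoneRearrangement {n : ℕ} {X : Type*} [MeasurableSpace X] (μ : Measure X)
    (u : X → EuclideanSpace ℝ (Fin n)) (Y : Set (EuclideanSpace ℝ (Fin n)))
    (v : EuclideanSpace ℝ (Fin n) → EuclideanSpace ℝ (Fin n)) : Prop :=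
  IsRearrangement u μ v (volume.restrict Y) ∧ IsConvexGradientOn v Y

/-- `u` has a polar factorisation through `Y`: almost everywhere `u = v ∘ s`, where `v` is the
monotone rearrangement of `u` on `Y` and `s : X → Y` is a measure-preserving mapping. -/
def HasPolarFactorisation {n : ℕ} {X : Type*} [MeasurableSpace X] (μ : Measure X)
    (u : X → EuclideanSpace ℝ (Fin n)) (Y : Set (EuclideanSpace ℝ (Fin n))) : Prop :=
  ∃ v : EuclideanSpace ℝ (Fin n) → EuclideanSpace ℝ (Fin n),
    IsMonotoneRearrangement μ u Y v ∧
    ∃ s : X → EuclideanSpace ℝ (Fin n), (∀ x, s x ∈ Y) ∧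
      MeasurePreserving s μ (volume.restrict Y) ∧ u =ᵐ[μ] v ∘ s

/-- The complement of the level sets of positive measure of `f`. -/
def nullLevelPart {α β : Type*} [MeasurableSpace α] (μ : Measure α) (f : α → β) : Set α :=
  {x | μ (f ⁻¹' {f x}) = 0}

/-- `f`, restricted to the set `A`, is almost injective. -/
def AlmostInjectiveOn {α β : Type*} [MeasurableSpace α] (μ : Measure α) (f : α → β)
    (A : Set α) : Prop :=
  ∃ U ⊆ A, μ (A \ U) = 0 ∧ InjOn f U

/-- `f`, restricted to the set `A`, is almost countable to one. -/
def AlmostCountableToOneOn {α β : Type*} [MeasurableSpace α] (μ : Measure α) (f : α → β)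
    (A : Set α) : Prop :=
  ∃ U ⊆ A, μ (A \ U) = 0 ∧ ∀ b : β, (U ∩ f ⁻¹' {b}).Countable

/-! Suppose `u = v ∘ s`. Gradients of convex functions with the same law agree almost everywhere
(`ae_eq_of_isConvexGradientOn_of_map_eq`), so `v` may be replaced by `uSharp`, and it remains to
show that countable fibres of `u` force `uSharp` to be almost injective off its nonnull level sets.

If two points share a gradient, the convex function `f` is affine on the segment between them, and
this segment crosses a rational coordinate hyperplane. Countably many hyperplanes occur, so if
almost injectivity fails, a single one serves a nonnull set of points. As `X` is a measure-interval,
the `s`-image of the good points over that set contains a compact `K` with nonnull preimage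
(`IsMeasureInterval.exists_isCompact_subset_image`), and `K` inherits countable gradient fibres from
`u`.

Such a `K` is null (`ConvexOn.volume_eq_zero_of_countable_gradient_fibers`). Slide its points a
fraction `r` of the way to the hyperplane along affine segments. The gradient, where it exists, is
unchanged, so a given point returns to `K` for only countably many `r`; by Fubini, for almost every
`r` almost no point returns. The slid set keeps at least the fraction `(1 - r) ^ n` of the volume
(`ConvexOn.volume_le_volume_slide`), so a positive volume of it lies outside `K` but within `O(r)`
of `K`. This is impossible as `r → 0`, since thickenings of a compact set shrink to it in volume. -/

/-! ### Gradients and subgradients of convex functions. -/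

theorem IsProperLscConvex.convexOn_toReal {n : ℕ} {ψ : EuclideanSpace ℝ (Fin n) → EReal}
    (h : IsProperLscConvex ψ) : ConvexOn ℝ {y | ψ y ≠ ⊤} (fun y => (ψ y).toReal) := by
  have key : ∀ x, ψ x ≠ ⊤ → ∀ y, ψ y ≠ ⊤ → ∀ a b : ℝ, 0 ≤ a → 0 ≤ b → a + b = 1 →
      ψ (a • x + b • y) ≤ ((a * (ψ x).toReal + b * (ψ y).toReal : ℝ) : EReal) := by
    intro x hx y hy a b ha hb hab
    have hx' : ((x, (ψ x).toReal) : EuclideanSpace ℝ (Fin n) × ℝ) ∈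
        {p : EuclideanSpace ℝ (Fin n) × ℝ | ψ p.1 ≤ (p.2 : EReal)} :=
      (EReal.coe_toReal hx (h.ne_bot x)).ge
    have hy' : ((y, (ψ y).toReal) : EuclideanSpace ℝ (Fin n) × ℝ) ∈
        {p : EuclideanSpace ℝ (Fin n) × ℝ | ψ p.1 ≤ (p.2 : EReal)} :=
      (EReal.coe_toReal hy (h.ne_bot y)).ge
    simpa using h.convex hx' hy' ha hb hab
  refine ⟨fun x hx y hy a b ha hb hab => ?_, fun x hx y hy a b ha hb hab => ?_⟩
  · exact ((key x hx y hy a b ha hb hab).trans_lt (EReal.coe_lt_top _)).ne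
  · have := key x hx y hy a b ha hb hab
    have h1 := EReal.toReal_le_toReal this (h.ne_bot _) (EReal.coe_ne_top _)
    rwa [EReal.toReal_coe] at h1

/-- At a point of differentiability, the gradient of a convex function is a subgradient. -/
theorem ConvexOn.add_inner_le_of_hasGradientAt {E : Type*} [NormedAddCommGroup E]
    [InnerProductSpace ℝ E] [CompleteSpace E] {s : Set E} {f : E → ℝ} (hf : ConvexOn ℝ s f)
    {x w p : E} (hx : x ∈ s) (hw : w ∈ s) (hp : HasGradientAt f p x) :
    f x + inner ℝ p (w - x) ≤ f w := by
  have h1 := hf.comp_affineMap (AffineMap.lineMap x w : ℝ →ᵃ[ℝ] E)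
  have h2 : HasDerivAt (f ∘ (AffineMap.lineMap x w : ℝ →ᵃ[ℝ] E)) (inner ℝ p (w - x)) 0 := by
    have h3 : HasDerivAt (AffineMap.lineMap x w : ℝ → E) (w - x) (0 : ℝ) :=
      AffineMap.hasDerivAt_lineMap
    have h4 : HasFDerivAt f (InnerProductSpace.toDual ℝ E p)
        ((AffineMap.lineMap x w : ℝ →ᵃ[ℝ] E) (0 : ℝ)) := by simpa using hp.hasFDerivAt
    simpa using h4.comp_hasDerivAt (0 : ℝ) h3
  have h5 := h1.le_slope_of_hasDerivAt (x := 0) (y := 1) (by simpa using hx) (by simpa using hw)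
    one_pos h2
  simp [slope_def_field] at h5
  linarith

theorem IsProperLscConvex.add_inner_le {n : ℕ} {ψ : EuclideanSpace ℝ (Fin n) → EReal}
    (h : IsProperLscConvex ψ) {p x : EuclideanSpace ℝ (Fin n)} (hp : HasExtGradientAt ψ p x)
    (w : EuclideanSpace ℝ (Fin n)) :
    (((ψ x).toReal + inner ℝ p (w - x) : ℝ) : EReal) ≤ ψ w := by
  by_cases hw : ψ w = ⊤
  · simp [hw]
  rw [← EReal.coe_toReal hw (h.ne_bot w), EReal.coe_le_coe_iff]
  exact h.convexOn_toReal.add_inner_le_of_hasGradientAt hp.1.self_of_nhds.1 hw hp.2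

/-- A differentiable function has at most one subgradient. -/
theorem HasGradientAt.eq_of_eventually_add_inner_le {E : Type*} [NormedAddCommGroup E]
    [InnerProductSpace ℝ E] [CompleteSpace E] {f : E → ℝ} {p q x : E} (hp : HasGradientAt f p x)
    (hq : ∀ᶠ w in 𝓝 x, f x + inner ℝ q (w - x) ≤ f w) : p = q := by
  have hmin : IsLocalMin (fun w => f w - inner ℝ q w) x := by
    filter_upwards [hq] with w hw
    rw [inner_sub_right] at hw
    linarith
  have hd : HasFDerivAt (fun w => f w - inner ℝ q w)
      (InnerProductSpace.toDual ℝ _ p - InnerProductSpace.toDual ℝ _ q) x :=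
    hp.hasFDerivAt.sub (InnerProductSpace.toDual ℝ _ q).hasFDerivAt
  exact (InnerProductSpace.toDual ℝ _).injective (sub_eq_zero.1 (hmin.hasFDerivAt_eq_zero hd))

/-! ### Uniqueness of the monotone rearrangement. -/

/-- Equal laws give equal integrals, and an ordered pair with equal integrals agrees almost
everywhere; composing with `arctan` supplies integrability. -/
theorem ae_eq_of_ae_le_of_map_eq {α : Type*} [MeasurableSpace α] {ν : Measure α}
    [IsFiniteMeasure ν] {f g : α → ℝ} (hf : AEMeasurable f ν) (hg : AEMeasurable g ν)
    (hfg : f ≤ᵐ[ν] g) (hmap : ν.map f = ν.map g) : f =ᵐ[ν] g := by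
  have hint : ∀ {k : α → ℝ}, AEMeasurable k ν → Integrable (fun x => Real.arctan (k x)) ν := by
    intro k hk
    refine Integrable.of_bound (Real.measurable_arctan.comp_aemeasurable hk).aestronglyMeasurable
      (Real.pi / 2) (ae_of_all _ fun x => ?_)
    rw [Real.norm_eq_abs, abs_le]
    exact ⟨(Real.neg_pi_div_two_lt_arctan _).le, (Real.arctan_lt_pi_div_two _).le⟩
  have harc : ∀ {m : Measure ℝ}, AEStronglyMeasurable Real.arctan m :=
    Real.measurable_arctan.aestronglyMeasurable
  have heq : ∫ x, Real.arctan (f x) ∂ν = ∫ x, Real.arctan (g x) ∂ν := by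
    rw [← integral_map hf harc, ← integral_map hg harc, hmap]
  have h0 : ∫ x, (Real.arctan (g x) - Real.arctan (f x)) ∂ν = 0 := by
    rw [integral_sub (hint hg) (hint hf), heq, sub_self]
  rw [integral_eq_zero_iff_of_nonneg_ae] at h0
  · filter_upwards [h0] with x hx
    exact Real.arctan_injective (sub_eq_zero.1 hx).symm
  · filter_upwards [hfg] with x hx
    exact sub_nonneg.2 (Real.arctan_strictMono.monotone hx)
  · exact (hint hg).sub (hint hf)

/-- The Legendre conjugate of an extended-real-valued function. -/
noncomputable def legendreConj {n : ℕ} (φ : EuclideanSpace ℝ (Fin n) → EReal)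
    (y : EuclideanSpace ℝ (Fin n)) : EReal :=
  ⨆ x, (((inner ℝ x y : ℝ) : EReal) - φ x)

theorem measurable_legendreConj {n : ℕ} {φ : EuclideanSpace ℝ (Fin n) → EReal}
    (hφ : ∀ x, φ x ≠ ⊥) : Measurable (legendreConj φ) := by
  refine LowerSemicontinuous.measurable (lowerSemicontinuous_iSup fun x => ?_)
  refine Continuous.lowerSemicontinuous ?_
  induction h : φ x with
  | bot => exact absurd h (hφ x)
  | top => simpa using continuous_const
  | coe a =>
    simp_rw [← EReal.coe_sub]
    exact continuous_coe_real_ereal.comp (by fun_prop)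

theorem legendreConj_eq {n : ℕ} {φ : EuclideanSpace ℝ (Fin n) → EReal} (hφ : ∀ x, φ x ≠ ⊥)
    {x p : EuclideanSpace ℝ (Fin n)} (hx : φ x ≠ ⊤)
    (h : ∀ w, (((φ x).toReal + inner ℝ p (w - x) : ℝ) : EReal) ≤ φ w) :
    legendreConj φ p = ((inner ℝ x p - (φ x).toReal : ℝ) : EReal) := by
  refine le_antisymm (iSup_le fun w => ?_) ?_
  · have hw := h w
    induction hc : φ w with
    | bot => exact absurd hc (hφ w)
    | top => simp
    | coe a =>
      rw [hc, EReal.coe_le_coe_iff, inner_sub_right, real_inner_comm w p,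
        real_inner_comm x p] at hw
      rw [← EReal.coe_sub, EReal.coe_le_coe_iff]
      linarith
  · refine le_trans (le_of_eq ?_)
      (le_iSup (fun x => (((inner ℝ x p : ℝ) : EReal) - φ x)) x)
    rw [EReal.coe_sub, EReal.coe_toReal hx (hφ x)]

theorem inner_sub_le_legendreConj {n : ℕ} {φ : EuclideanSpace ℝ (Fin n) → EReal}
    (hφ : ∀ x, φ x ≠ ⊥) {x p : EuclideanSpace ℝ (Fin n)} (hx : φ x ≠ ⊤)
    (hp : legendreConj φ p ≠ ⊤) :
    inner ℝ x p - (φ x).toReal ≤ (legendreConj φ p).toReal := by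
  have h : ((inner ℝ x p - (φ x).toReal : ℝ) : EReal) ≤ legendreConj φ p := by
    refine le_trans (le_of_eq ?_)
      (le_iSup (fun x => (((inner ℝ x p : ℝ) : EReal) - φ x)) x)
    rw [EReal.coe_sub, EReal.coe_toReal hx (hφ x)]
  have h1 := EReal.toReal_le_toReal h (EReal.coe_ne_bot _) hp
  rwa [EReal.toReal_coe] at h1

/-- Equality in Young's inequality makes `p` a subgradient at `x`. -/
theorem add_inner_le_of_legendreConj_toReal_eq {n : ℕ} {φ : EuclideanSpace ℝ (Fin n) → EReal}
    (hφ : ∀ x, φ x ≠ ⊥) {x p : EuclideanSpace ℝ (Fin n)}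
    (hp : legendreConj φ p ≠ ⊤)
    (h : (legendreConj φ p).toReal = inner ℝ x p - (φ x).toReal)
    {w : EuclideanSpace ℝ (Fin n)} (hw : φ w ≠ ⊤) :
    (φ x).toReal + inner ℝ p (w - x) ≤ (φ w).toReal := by
  have h1 := inner_sub_le_legendreConj hφ hw hp
  rw [inner_sub_right, real_inner_comm w p, real_inner_comm x p]
  linarith

/-- Two gradients of convex functions with the same law agree almost everywhere. -/
theorem ae_eq_of_isConvexGradientOn_of_map_eq {n : ℕ} {Y : Set (EuclideanSpace ℝ (Fin n))}
    [IsFiniteMeasure ((volume : Measure (EuclideanSpace ℝ (Fin n))).restrict Y)]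
    {v₁ v₂ : EuclideanSpace ℝ (Fin n) → EuclideanSpace ℝ (Fin n)}
    (h₁ : IsConvexGradientOn v₁ Y) (h₂ : IsConvexGradientOn v₂ Y)
    (hm₁ : AEMeasurable v₁ (volume.restrict Y)) (hm₂ : AEMeasurable v₂ (volume.restrict Y))
    (hmap : (volume.restrict Y).map v₁ = (volume.restrict Y).map v₂) :
    v₁ =ᵐ[volume.restrict Y] v₂ := by
  obtain ⟨φ, hφ, hφv⟩ := h₁
  obtain ⟨ψ, hψ, hψv⟩ := h₂
  set ν := (volume : Measure (EuclideanSpace ℝ (Fin n))).restrict Y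
  have mφ := measurable_legendreConj hφ.ne_bot
  have mψ := measurable_legendreConj hψ.ne_bot
  have transfer : ∀ S : Set (EuclideanSpace ℝ (Fin n)), MeasurableSet S →
      ((∀ᵐ x ∂ν, v₁ x ∈ S) ↔ ∀ᵐ x ∂ν, v₂ x ∈ S) := by
    intro S hS
    exact (ae_map_iff hm₁ hS).symm.trans (hmap ▸ ae_map_iff hm₂ hS)
  have mS : ∀ {k : EuclideanSpace ℝ (Fin n) → EReal}, Measurable k →
      MeasurableSet {y | k y ≠ ⊤} := fun hk =>
    (hk (measurableSet_singleton _)).compl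
  have e₁ : ∀ᵐ x ∂ν, legendreConj φ (v₁ x) = ((inner ℝ x (v₁ x) - (φ x).toReal : ℝ) : EReal) := by
    filter_upwards [hφv] with x hx
    exact legendreConj_eq hφ.ne_bot hx.1.self_of_nhds.1 (hφ.add_inner_le hx)
  have e₂ : ∀ᵐ x ∂ν, legendreConj ψ (v₂ x) = ((inner ℝ x (v₂ x) - (ψ x).toReal : ℝ) : EReal) := by
    filter_upwards [hψv] with x hx
    exact legendreConj_eq hψ.ne_bot hx.1.self_of_nhds.1 (hψ.add_inner_le hx)
  have t₁ : ∀ᵐ x ∂ν, legendreConj φ (v₂ x) ≠ ⊤ := by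
    refine (transfer _ (mS mφ)).1 ?_
    filter_upwards [e₁] with x hx
    simp only [hx]
    exact EReal.coe_ne_top _
  have t₂ : ∀ᵐ x ∂ν, legendreConj ψ (v₁ x) ≠ ⊤ := by
    refine (transfer _ (mS mψ)).2 ?_
    filter_upwards [e₂] with x hx
    simp only [hx]
    exact EReal.coe_ne_top _
  -- Young's inequality, with equality for `φ` at `v₁` and for `ψ` at `v₂`, gives `k ∘ v₂ ≤ h ≤ k ∘
  -- v₁`. The outer functions have the same law, so all three agree almost everywhere.
  let k : EuclideanSpace ℝ (Fin n) → ℝ := fun y =>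
    (legendreConj ψ y).toReal - (legendreConj φ y).toReal
  have mk : Measurable k := mψ.ereal_toReal.sub mφ.ereal_toReal
  let h : EuclideanSpace ℝ (Fin n) → ℝ := fun x => (φ x).toReal - (ψ x).toReal
  have hle₁ : ∀ᵐ x ∂ν, h x ≤ k (v₁ x) := by
    filter_upwards [e₁, t₂, hψv] with x h1 h2 h3
    have := inner_sub_le_legendreConj hψ.ne_bot h3.1.self_of_nhds.1 h2
    simp only [h, k, h1, EReal.toReal_coe]
    linarith
  have hle₂ : ∀ᵐ x ∂ν, k (v₂ x) ≤ h x := by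
    filter_upwards [e₂, t₁, hφv] with x h1 h2 h3
    have := inner_sub_le_legendreConj hφ.ne_bot h3.1.self_of_nhds.1 h2
    simp only [h, k, h1, EReal.toReal_coe]
    linarith
  have heq : (fun x => k (v₂ x)) =ᵐ[ν] fun x => k (v₁ x) := by
    refine ae_eq_of_ae_le_of_map_eq (mk.comp_aemeasurable hm₂) (mk.comp_aemeasurable hm₁) ?_ ?_
    · filter_upwards [hle₁, hle₂] with x h1 h2 using h2.trans h1
    · have a₁ := AEMeasurable.map_map_of_aemeasurable (mk.aemeasurable (μ := ν.map v₁)) hm₁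
      have a₂ := AEMeasurable.map_map_of_aemeasurable (mk.aemeasurable (μ := ν.map v₂)) hm₂
      exact a₂.symm.trans ((congrArg (fun m => Measure.map k m) hmap.symm).trans a₁)
  filter_upwards [heq, hle₁, hle₂, e₁, t₂, hψv] with x hk h1 h2 h3 h4 h5
  have hkx : (legendreConj ψ (v₁ x)).toReal = inner ℝ x (v₁ x) - (ψ x).toReal := by
    have : k (v₁ x) = h x := le_antisymm (hk ▸ h2) h1
    simp only [h, k, h3, EReal.toReal_coe] at this
    linarith
  refine (h5.2.eq_of_eventually_add_inner_le ?_).symm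
  filter_upwards [h5.1] with w hw
  exact add_inner_le_of_legendreConj_toReal_eq hψ.ne_bot h4 hkx hw.1

/-! ### Volume of sets slid along affine segments. -/

/-- If two optimal moves arrive at the same point `y`, then `y` is the midpoint of the arrival
points with targets swapped. Adding the two optimality inequalities contradicts strict convexity at
`y`, unless the swapped points coincide, which forces `z = z'`. -/
theorem StrictConvexOn.cells_unique {E : Type*} [AddCommGroup E] [Module ℝ E]
    {Ω : Set E} {c g : E → ℝ} (hc : StrictConvexOn ℝ Ω c) {r : ℝ} (hr0 : 0 < r) (hr1 : r < 1)
    {x x' z z' : E} (hx : x ∈ Ω) (hx' : x' ∈ Ω) (hz : z ∈ Ω) (hz' : z' ∈ Ω)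
    (h : c ((1 - r) • x + r • z') - g z' ≤ c ((1 - r) • x + r • z) - g z)
    (h' : c ((1 - r) • x' + r • z) - g z ≤ c ((1 - r) • x' + r • z') - g z')
    (heq : (1 - r) • x + r • z = (1 - r) • x' + r • z') : z = z' := by
  by_contra hne
  have hmem : ∀ {a b : E}, a ∈ Ω → b ∈ Ω → (1 - r) • a + r • b ∈ Ω := fun ha hb =>
    hc.1 ha hb (by linarith) hr0.le (by ring)
  have hab : (1 - r) • x + r • z' ≠ (1 - r) • x' + r • z := by
    intro hab
    have h1 : ((2 : ℝ) * r) • (z - z') = 0 := by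
      have : ((2 : ℝ) * r) • (z - z') = ((1 - r) • x + r • z - ((1 - r) • x' + r • z'))
        - ((1 - r) • x + r • z' - ((1 - r) • x' + r • z)) := by module
      rw [this, heq, hab]; simp
    rcases smul_eq_zero.1 h1 with h2 | h2
    · linarith
    · exact hne (sub_eq_zero.1 h2)
  have h1 := hc.2 (hmem hx hz') (hmem hx' hz) hab (by norm_num : (0 : ℝ) < 1 / 2)
    (by norm_num : (0 : ℝ) < 1 / 2) (by norm_num)
  have h2 : (1 / 2 : ℝ) • ((1 - r) • x + r • z') + (1 / 2 : ℝ) • ((1 - r) • x' + r • z)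
      = (1 - r) • x + r • z := by
    have : (1 / 2 : ℝ) • ((1 - r) • x + r • z') + (1 / 2 : ℝ) • ((1 - r) • x' + r • z)
      = (1 / 2 : ℝ) • ((1 - r) • x + r • z) + (1 / 2 : ℝ) • ((1 - r) • x' + r • z') := by module
    rw [this, ← heq]; module
  rw [h2] at h1
  rw [← heq] at h'
  simp only [smul_eq_mul] at h1
  linarith

theorem image_smul_add_eq_homothety {E : Type*} [NormedAddCommGroup E] [NormedSpace ℝ E] (r : ℝ) (z : E) (C : Set E) :
    (fun x => (1 - r) • x + r • z) '' C = AffineMap.homothety z (1 - r) '' C := by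
  refine image_congr fun x _ => ?_
  simp only [AffineMap.homothety_apply, vsub_eq_sub, vadd_eq_add]
  module

/-- Moving each point of `K` towards the point of a finite set maximising a strictly convex
reward contracts volumes by at most the factor of a homothety. -/
theorem volume_le_of_finite_targets {E : Type*} [NormedAddCommGroup E] [InnerProductSpace ℝ E]
    [FiniteDimensional ℝ E] [MeasurableSpace E] [BorelSpace E]
    {Ω K V : Set E} {c g : E → ℝ}
    (hc : StrictConvexOn ℝ Ω c) (hcc : ContinuousOn c Ω) (hK : IsCompact K) (hKΩ : K ⊆ Ω)
    (t : Finset E) (ht : t.Nonempty) (htΩ : ↑t ⊆ Ω) {r : ℝ} (hr0 : 0 < r) (hr1 : r < 1)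
    (hV : ∀ x ∈ K, ∀ z ∈ t, (∀ z' ∈ t, c ((1 - r) • x + r • z') - g z' ≤
      c ((1 - r) • x + r • z) - g z) → (1 - r) • x + r • z ∈ V) :
    ENNReal.ofReal ((1 - r) ^ Module.finrank ℝ E) * volume K ≤ volume V := by
  -- The cell of points for which `z` is an optimal target. On each cell the move is a homothety of
  -- ratio `1 - r`, and images of different cells are disjoint.
  let C : E → Set E := fun z => {x ∈ K | ∀ z' ∈ t, c ((1 - r) • x + r • z') - g z' ≤
      c ((1 - r) • x + r • z) - g z}
  have hcont : ∀ z ∈ t, ContinuousOn (fun x => c ((1 - r) • x + r • z) - g z) K := by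
    intro z hz
    refine (hcc.comp (by fun_prop) fun x hx => ?_).sub continuousOn_const
    exact hc.1 (hKΩ hx) (htΩ hz) (by linarith) hr0.le (by ring)
  have hCc : ∀ z ∈ t, IsCompact (C z) := by
    intro z hz
    have : C z = K ∩ ⋂ z' ∈ t, {x ∈ K | c ((1 - r) • x + r • z') - g z' ≤
        c ((1 - r) • x + r • z) - g z} := by
      ext x
      simp only [C, mem_inter_iff, mem_iInter, mem_ofPred_eq]
      exact ⟨fun h => ⟨h.1, fun z' hz' => ⟨h.1, h.2 z' hz'⟩⟩, fun h => ⟨h.1, fun z' hz' => (h.2 z' hz').2⟩⟩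
    rw [this]
    exact hK.inter_right (isClosed_biInter fun z' hz' =>
      hK.isClosed.isClosed_le (hcont z' hz') (hcont z hz))
  have hcover : K ⊆ ⋃ z ∈ t, C z := by
    intro x hx
    obtain ⟨z, hz, hmax⟩ := t.exists_max_image (fun z => c ((1 - r) • x + r • z) - g z) ht
    exact mem_iUnion₂.2 ⟨z, hz, hx, hmax⟩
  have hdisj : (↑t : Set E).PairwiseDisjoint fun z => (fun x => (1 - r) • x + r • z) '' C z := by
    intro z hz z' hz' hne
    refine disjoint_left.2 ?_
    rintro y ⟨x, hx, rfl⟩ ⟨x', hx', hxx⟩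
    exact hne (hc.cells_unique hr0 hr1 (hKΩ hx.1) (hKΩ hx'.1) (htΩ hz) (htΩ hz')
      (hx.2 z' hz') (hx'.2 z hz) hxx.symm)
  have hvol : ∀ z, volume ((fun x => (1 - r) • x + r • z) '' C z) =
      ENNReal.ofReal ((1 - r) ^ Module.finrank ℝ E) * volume (C z) := by
    intro z
    rw [image_smul_add_eq_homothety, Measure.addHaar_image_homothety, abs_of_nonneg]
    exact pow_nonneg (by linarith) _
  calc ENNReal.ofReal ((1 - r) ^ Module.finrank ℝ E) * volume K
      ≤ ENNReal.ofReal ((1 - r) ^ Module.finrank ℝ E) * ∑ z ∈ t, volume (C z) := by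
        gcongr
        exact (measure_mono hcover).trans (measure_biUnion_finset_le _ _)
    _ = ∑ z ∈ t, volume ((fun x => (1 - r) • x + r • z) '' C z) := by
        simp_rw [hvol, Finset.mul_sum]
    _ = volume (⋃ z ∈ t, (fun x => (1 - r) • x + r • z) '' C z) := by
        refine (measure_biUnion_finset hdisj fun z hz => ?_).symm
        exact ((hCc z hz).image (by fun_prop)).measurableSet
    _ ≤ volume V := by
        refine measure_mono (iUnion₂_subset fun z hz => ?_)
        rintro _ ⟨x, hx, rfl⟩
        exact hV x hx.1 z hz hx.2

/-- Sliding the points of `K` along segments on which a convex function is affine contracts volumes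
by at most the factor of a homothety. -/
theorem ConvexOn.volume_le_volume_slide {E : Type*} [NormedAddCommGroup E] [InnerProductSpace ℝ E]
    [FiniteDimensional ℝ E] [MeasurableSpace E] [BorelSpace E]
    {Ω K Z : Set E} {f : E → ℝ}
    (hf : ConvexOn ℝ Ω f) (hfc : ContinuousOn f Ω) (hK : IsCompact K) (hKΩ : K ⊆ Ω)
    (hZ : IsCompact Z) (hZΩ : Z ⊆ Ω) {r : ℝ} (hr0 : 0 < r) (hr1 : r < 1)
    (hKZ : ∀ x ∈ K, ∃ z ∈ Z, f ((1 - r) • x + r • z) = (1 - r) * f x + r * f z) :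
    ENNReal.ofReal ((1 - r) ^ Module.finrank ℝ E) * volume K ≤
      volume {y | ∃ x ∈ K, ∃ z ∈ Z, f ((1 - r) • x + r • z) = (1 - r) * f x + r * f z ∧
        y = (1 - r) • x + r • z} := by
  rcases K.eq_empty_or_nonempty with rfl | hKne
  · simp
  rw [Set.measure_eq_iInf_isOpen {y | _}]
  simp only [le_iInf_iff]
  intro V hV hVo
  have hslide : Continuous fun p : E × E => (1 - r) • p.1 + r • p.2 := by fun_prop
  have hmaps : MapsTo (fun p : E × E => (1 - r) • p.1 + r • p.2) (K ×ˢ Z) Ω := fun p hp =>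
    hf.1 (hKΩ hp.1) (hZΩ hp.2) (by linarith) hr0.le (by ring)
  have hKZc : IsCompact (K ×ˢ Z) := hK.prod hZ
  -- By convexity `F (x, z) ≤ (1 - r) * f x`, with equality exactly for the affine targets: these
  -- maximise the reward `F (x, ·)`. Targets landing outside `V` miss the maximum by a uniform `η`.
  let F : E × E → ℝ := fun p => f ((1 - r) • p.1 + r • p.2) - r * f p.2
  have hF : ContinuousOn F (K ×ˢ Z) :=
    (hfc.comp hslide.continuousOn hmaps).sub
      ((hfc.comp continuousOn_snd fun p hp => hZΩ hp.2).const_smul r)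
  have hG : ContinuousOn (fun p : E × E => (1 - r) * f p.1 - F p) (K ×ˢ Z) :=
    ((hfc.comp continuousOn_fst fun p hp => hKΩ hp.1).const_smul (1 - r)).sub hF
  obtain ⟨η, hη, hηG⟩ : ∃ η > 0, ∀ x ∈ K, ∀ z ∈ Z, (1 - r) • x + r • z ∉ V →
      η ≤ (1 - r) * f x - F (x, z) := by
    let S : Set (E × E) := (K ×ˢ Z) ∩ (fun p : E × E => (1 - r) • p.1 + r • p.2) ⁻¹' Vᶜ
    have hSc : IsCompact S := hKZc.inter_right (hVo.isClosed_compl.preimage hslide)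
    have hmem : ∀ x ∈ K, ∀ z ∈ Z, (1 - r) • x + r • z ∉ V → (x, z) ∈ S :=
      fun x hx z hz hxz => ⟨⟨hx, hz⟩, hxz⟩
    rcases S.eq_empty_or_nonempty with hS | hS
    · exact ⟨1, one_pos, fun x hx z hz hxz => absurd (hmem x hx z hz hxz)
        (hS ▸ notMem_empty (x, z))⟩
    · obtain ⟨p, hp, hmin⟩ := hSc.exists_isMinOn hS (hG.mono inter_subset_left)
      refine ⟨_, ?_, fun x hx z hz hxz => hmin (hmem x hx z hz hxz)⟩
      have h1 := hf.2 (hKΩ hp.1.1) (hZΩ hp.1.2) (by linarith : 0 ≤ 1 - r) hr0.le (by ring)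
      have h2 : f ((1 - r) • p.1 + r • p.2) ≠ (1 - r) * f p.1 + r * f p.2 := fun h =>
        hp.2 (hV ⟨p.1, hp.1.1, p.2, hp.1.2, h, rfl⟩)
      simp only [smul_eq_mul] at h1
      have := lt_of_le_of_ne h1 h2
      simp only [F]
      linarith
  obtain ⟨δ, hδ, hδF⟩ := Metric.uniformContinuousOn_iff.1
    (hKZc.uniformContinuousOn_of_continuous hF) (η / 2) (half_pos hη)
  obtain ⟨M, hM⟩ := hKZc.exists_bound_of_continuousOn
    (f := fun p : E × E => ‖(1 - r) • p.1 + r • p.2‖ ^ 2) (by fun_prop)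
  have hM0 : ∀ x ∈ K, ∀ z ∈ Z, ‖(1 - r) • x + r • z‖ ^ 2 ≤ |M| := fun x hx z hz =>
    (le_abs_self _).trans ((hM (x, z) ⟨hx, hz⟩).trans (le_abs_self _))
  -- The quadratic term makes the reward strictly convex in the arrival point and costs less than `η
  -- / 2`; replacing `Z` by a finite `δ`-net costs less than another `η / 2`. Optimal targets in the
  -- net therefore still land in `V`.
  let ε : ℝ := η / (2 * (|M| + 1))
  have hε : 0 < ε := by positivity
  have hεM : ε * |M| < η / 2 := by
    have : ε * (|M| + 1) = η / 2 := by simp only [ε]; field_simp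
    nlinarith
  obtain ⟨T, hTZ, hTfin, hTcov⟩ := hZ.finite_cover_balls hδ
  have hnet : ∀ z ∈ Z, ∃ z' ∈ hTfin.toFinset, dist z z' < δ := by
    intro z hz
    obtain ⟨z', hz', hd⟩ := mem_iUnion₂.1 (hTcov hz)
    exact ⟨z', hTfin.mem_toFinset.2 hz', hd⟩
  have htne : hTfin.toFinset.Nonempty := by
    obtain ⟨x, hx⟩ := hKne
    obtain ⟨z, hz, -⟩ := hKZ x hx
    obtain ⟨z', hz', -⟩ := hnet z hz
    exact ⟨z', hz'⟩
  have hc : StrictConvexOn ℝ Ω fun y => f y + ε * ‖y‖ ^ 2 := by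
    refine StrongConvexOn.strictConvexOn (m := 2 * ε) ?_ (by linarith)
    rw [strongConvexOn_iff_convex]
    convert! hf using 2
    ring
  refine volume_le_of_finite_targets (g := fun z => r * f z) hc (by fun_prop) hK hKΩ
    hTfin.toFinset htne (by simpa using hTZ.trans hZΩ) hr0 hr1 fun x hx z hz hopt => ?_
  have hzZ : z ∈ Z := hTZ (hTfin.mem_toFinset.1 hz)
  by_contra hnV
  have h1 := hηG x hx z hzZ hnV
  obtain ⟨w, hw, hweq⟩ := hKZ x hx
  obtain ⟨z', hz', hd⟩ := hnet w hw
  have h2 := hopt z' hz'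
  have h3 := hδF (x, w) ⟨hx, hw⟩ (x, z') ⟨hx, hTZ (hTfin.mem_toFinset.1 hz')⟩
    (by simpa [Prod.dist_eq] using hd)
  rw [Real.dist_eq] at h3
  have h4 := (abs_lt.1 h3).2
  have h5 := mul_le_mul_of_nonneg_left (hM0 x hx z hzZ) hε.le
  have h6 : 0 ≤ ε * ‖(1 - r) • x + r • z'‖ ^ 2 := by positivity
  simp only [F] at h1 h4
  linarith

/-! ### Affine segments and sets with countable gradient fibres. -/

/-- The point at `s` lies between the point at `r` and `z`, so a strict inequality at `r` would
persist at `s`. -/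
theorem ConvexOn.affine_of_affine_at {E : Type*} [AddCommGroup E] [Module ℝ E] {Ω : Set E}
    {f : E → ℝ} (hf : ConvexOn ℝ Ω f) {x z : E} (hx : x ∈ Ω) (hz : z ∈ Ω) {s : ℝ} (hs : s < 1)
    (h : f ((1 - s) • x + s • z) = (1 - s) * f x + s * f z) {r : ℝ} (hr0 : 0 ≤ r)
    (hr : r ≤ s) : f ((1 - r) • x + r • z) = (1 - r) * f x + r * f z := by
  have h1r : 0 < 1 - r := by linarith
  have h1s : 0 < 1 - s := by linarith
  have h1 := hf.2 hx hz h1r.le hr0 (by ring)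
  refine le_antisymm h1 ?_
  let a : ℝ := (1 - s) / (1 - r)
  have ha0 : 0 < a := by positivity
  have ha : a * (1 - r) = 1 - s := by simp only [a]; field_simp
  have ha1 : 0 ≤ 1 - a := by nlinarith
  have hmem : (1 - r) • x + r • z ∈ Ω := hf.1 hx hz h1r.le hr0 (by ring)
  have h2 := hf.2 hmem hz ha0.le ha1 (by ring)
  have h3 : a • ((1 - r) • x + r • z) + (1 - a) • z = (1 - s) • x + s • z := by
    have : a • ((1 - r) • x + r • z) + (1 - a) • z
        = (a * (1 - r)) • x + (1 - a * (1 - r)) • z := by module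
    rw [this, ha]
    simp
  rw [h3, h] at h2
  simp only [smul_eq_mul] at h2
  have h4 : a * ((1 - r) * f x + r * f z) = (1 - s) * f x + (a - (1 - s)) * f z := by
    linear_combination (f x - f z) * ha
  nlinarith

theorem ConvexOn.affine_of_affine_at_of_le {E : Type*} [AddCommGroup E] [Module ℝ E] {Ω : Set E}
    {f : E → ℝ} (hf : ConvexOn ℝ Ω f) {x z : E} (hx : x ∈ Ω) (hz : z ∈ Ω) {s : ℝ} (hs : 0 < s)
    (h : f ((1 - s) • x + s • z) = (1 - s) * f x + s * f z) {r : ℝ} (hr1 : r ≤ 1)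
    (hr : s ≤ r) : f ((1 - r) • x + r • z) = (1 - r) * f x + r * f z := by
  have h1 := hf.affine_of_affine_at hz hx (s := 1 - s) (by linarith)
    (by rw [sub_sub_cancel, add_comm, h]; ring) (r := 1 - r) (by linarith) (by linarith)
  rw [sub_sub_cancel, add_comm] at h1
  rw [h1]; ring

/-- Gradients of a convex function agree along a segment on which it is affine. -/
theorem ConvexOn.gradient_eq_of_affine_on_segment {E : Type*} [NormedAddCommGroup E]
    [InnerProductSpace ℝ E] [CompleteSpace E] {Ω : Set E} {f : E → ℝ} (hf : ConvexOn ℝ Ω f)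
    (hΩ : IsOpen Ω) {x y z p q : E} (hx : x ∈ Ω) (hz : z ∈ Ω) (hy : y ∈ Ω)
    {r : ℝ} (hr0 : 0 < r) (hr1 : r < 1) (hyr : y = (1 - r) • x + r • z)
    (h : f y = (1 - r) * f x + r * f z) (hp : HasGradientAt f p x) (hq : HasGradientAt f q y) :
    p = q := by
  have h1 := hf.add_inner_le_of_hasGradientAt hy hx hq
  have h2 := hf.add_inner_le_of_hasGradientAt hy hz hq
  have h3 : (1 - r) * inner ℝ q (x - y) + r * inner ℝ q (z - y) = 0 := by
    rw [← real_inner_smul_right, ← real_inner_smul_right, ← inner_add_right]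
    have : (1 - r) • (x - y) + r • (z - y) = 0 := by rw [hyr]; module
    rw [this, inner_zero_right]
  have h4 : f y + inner ℝ q (x - y) = f x := by nlinarith
  refine hp.eq_of_eventually_add_inner_le ?_
  filter_upwards [hΩ.mem_nhds hx] with w hw
  have h5 := hf.add_inner_le_of_hasGradientAt hy hw hq
  rw [← h4, add_assoc, ← inner_add_right]
  convert! h5 using 3
  abel

/-- A compact set whose points are joined to a hyperplane section by segments on which a convex
function is affine is null if it meets the level sets of the gradient in countable sets. -/
theorem ConvexOn.volume_eq_zero_of_countable_gradient_fibers {E : Type*} [NormedAddCommGroup E]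
    [InnerProductSpace ℝ E] [FiniteDimensional ℝ E] [MeasurableSpace E] [BorelSpace E]
    {Ω K Z : Set E} {f : E → ℝ} {v : E → E} (hf : ConvexOn ℝ Ω f) (hΩ : IsOpen Ω)
    (hK : IsCompact K) (hKΩ : K ⊆ Ω) (hZ : IsCompact Z) (hZΩ : Z ⊆ Ω)
    (hv : ∀ x ∈ K, HasGradientAt f (v x) x) (hcount : ∀ b, (K ∩ v ⁻¹' {b}).Countable)
    (l : E →L[ℝ] ℝ) (q : ℝ) (hKq : ∀ x ∈ K, l x ≠ q) (hZq : ∀ z ∈ Z, l z = q)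
    {s : ℝ} (hs0 : 0 < s) (hs1 : s < 1)
    (hKZ : ∀ x ∈ K, ∃ z ∈ Z, f ((1 - s) • x + s • z) = (1 - s) * f x + s * f z) :
    volume K = 0 := by
  have hfc := hf.continuousOn hΩ
  let S : Set (E × E) := {p ∈ K ×ˢ Z |
    f ((1 - s) • p.1 + s • p.2) = (1 - s) * f p.1 + s * f p.2}
  have hS : IsCompact S := by
    refine (hK.prod hZ).of_isClosed_subset ?_ (sep_subset _ _)
    refine IsClosed.isClosed_eq (hK.prod hZ).isClosed ?_ ?_
    · refine hfc.comp (by fun_prop) fun p hp => ?_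
      exact hf.1 (hKΩ hp.1) (hZΩ hp.2) (by linarith) hs0.le (by ring)
    · exact ((hfc.comp continuousOn_fst fun p hp => hKΩ hp.1).const_smul (1 - s)).add
        ((hfc.comp continuousOn_snd fun p hp => hZΩ hp.2).const_smul s)
  have haff : ∀ p ∈ S, ∀ r : ℝ, 0 ≤ r → r ≤ s →
      f ((1 - r) • p.1 + r • p.2) = (1 - r) * f p.1 + r * f p.2 := fun p hp r hr0 hr1 =>
    hf.affine_of_affine_at (hKΩ hp.1.1) (hZΩ hp.1.2) hs1 hp.2 hr0 hr1
  -- the parameters at which a slid point returns to `K`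
  let A : Set (E × ℝ) := (fun t : (E × E) × ℝ => (t.1.1, t.2)) ''
    ((S ×ˢ Icc (0 : ℝ) s) ∩
      (fun t : (E × E) × ℝ => (1 - t.2) • t.1.1 + t.2 • t.1.2) ⁻¹' K)
  have hA : MeasurableSet A := by
    refine IsCompact.measurableSet (IsCompact.image ?_ (by fun_prop))
    exact (hS.prod isCompact_Icc).inter_right (hK.isClosed.preimage (by fun_prop))
  have hAx : ∀ x, {r | (x, r) ∈ A}.Countable := by
    intro x
    -- For `r > 0` a return point `y` has the gradient of `x`, so it lies in a countable fibre.
    -- Since `l = q` on `Z`, the value `l y` determines `r` whichever `z` was used.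
    refine Countable.mono (s₂ := insert 0 ((fun y => (l x - l y) / (l x - q)) ''
      (K ∩ v ⁻¹' {v x}))) ?_ (((hcount (v x)).image _).insert 0)
    rintro r ⟨⟨⟨x', z⟩, r'⟩, ⟨⟨hxz, hr⟩, hy⟩, heq⟩
    obtain ⟨rfl, rfl⟩ := Prod.mk.inj heq
    rcases hr.1.eq_or_lt with h0 | h0
    · exact Or.inl h0.symm
    refine Or.inr ⟨_, ⟨hy, ?_⟩, ?_⟩
    · refine (hf.gradient_eq_of_affine_on_segment hΩ (hKΩ hxz.1.1) (hZΩ hxz.1.2) (hKΩ hy) h0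
        (by linarith [hr.2]) rfl (haff _ hxz _ hr.1 hr.2) (hv _ hxz.1.1) (hv _ hy)).symm
    · have h1 : l x' - q ≠ 0 := sub_ne_zero.2 (hKq _ hxz.1.1)
      simp only [map_add, map_smul, smul_eq_mul, hZq z hxz.1.2]
      field_simp
      ring
  have hnull : ∀ᵐ r : ℝ, ∀ᵐ x : E, (x, r) ∉ A := by
    rw [← Measure.ae_ae_comm hA.compl]
    exact ae_of_all _ fun x => (hAx x).ae_notMem volume
  obtain ⟨R, hR0, hR⟩ : ∃ R > 0, ∀ x ∈ K, ∀ z ∈ Z, ‖z - x‖ ≤ R := by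
    obtain ⟨M, hM⟩ := (hK.prod hZ).exists_bound_of_continuousOn
      (f := fun p : E × E => p.2 - p.1) (by fun_prop)
    exact ⟨max M 1, by positivity, fun x hx z hz => (hM (x, z) ⟨hx, hz⟩).trans (le_max_left _ _)⟩
  by_contra hpos
  have hKfin : volume K ≠ ⊤ := hK.measure_lt_top.ne
  -- A lower bound for the contraction factors `(1 - r) ^ d` that is uniform in `r < s`.
  set c : ENNReal := ENNReal.ofReal ((1 - s) ^ Module.finrank ℝ E) with hc
  have hc0 : c ≠ 0 := by
    rw [hc, ne_eq, ENNReal.ofReal_eq_zero, not_le]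
    exact pow_pos (by linarith) _
  have hhalf : volume K / 2 ≠ 0 := (ENNReal.half_pos hpos).ne'
  have hch : c * (volume K / 2) ≠ 0 := mul_ne_zero hc0 hhalf
  have hlim : Tendsto (fun r : ℝ => volume (Metric.cthickening (r * R) K)) (𝓝 0)
      (𝓝 (volume K)) := by
    refine (tendsto_measure_cthickening_of_isCompact hK).comp ?_
    have : Tendsto (fun r : ℝ => r * R) (𝓝 0) (𝓝 (0 * R)) :=
      (continuous_id.mul continuous_const).tendsto 0
    rwa [zero_mul] at this
  have hev := hlim.eventually_lt_const (ENNReal.lt_add_right hKfin hch)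
  obtain ⟨δ, hδ, hball⟩ := Metric.eventually_nhds_iff.1 hev
  obtain ⟨r, hr, hr0, hrlt⟩ := (Measure.dense_of_ae hnull).exists_between
    (show (0 : ℝ) < min δ s by positivity)
  have hrδ : r < δ := hrlt.trans_le (min_le_left _ _)
  have hr2 : r < s := hrlt.trans_le (min_le_right _ _)
  have hthick := hball (y := r) (by rwa [Real.dist_eq, sub_zero, abs_of_pos hr0])
  have hmeas : MeasurableSet {x | (x, r) ∈ A} := measurable_prodMk_right hA
  have hKA : volume (K \ {x | (x, r) ∈ A}) = volume K := by
    refine measure_sdiff_null ?_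
    have := ae_iff.1 hr
    simpa using this
  obtain ⟨K', hK'sub, hK'c, hK'vol⟩ := (hK.measurableSet.diff hmeas).exists_lt_isCompact_of_ne_top
    (hKA ▸ hKfin) (hKA.symm ▸ ENNReal.half_lt_self hpos hKfin : volume K / 2 < _)
  have hslide := hf.volume_le_volume_slide hfc hK'c (fun x hx => hKΩ (hK'sub hx).1) hZ hZΩ hr0
    (by linarith) fun x hx => by
      obtain ⟨z, hz, hxz⟩ := hKZ x (hK'sub hx).1
      exact ⟨z, hz, hf.affine_of_affine_at (hKΩ (hK'sub hx).1) (hZΩ hz) hs1 hxz hr0.le hr2.le⟩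
  set Φ := {y | ∃ x ∈ K', ∃ z ∈ Z, f ((1 - r) • x + r • z) = (1 - r) * f x + r * f z ∧
    y = (1 - r) • x + r • z} with hΦ
  have hlow : c * (volume K / 2) ≤ volume Φ := by
    refine le_trans ?_ hslide
    have : 0 ≤ 1 - s := by linarith
    rw [hc]
    gcongr
  have hdisj : Disjoint K Φ := by
    refine disjoint_left.2 ?_
    rintro _ hy ⟨x, hx, z, hz, hxz, rfl⟩
    -- Affinity at `r` carries over to `s`, so the pair belongs to `S` and the return is recorded in
    -- `A`.
    have h1 := hf.affine_of_affine_at_of_le (hKΩ (hK'sub hx).1) (hZΩ hz) hr0 hxz hs1.le hr2.le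
    exact (hK'sub hx).2 ⟨((x, z), r), ⟨⟨⟨⟨(hK'sub hx).1, hz⟩, h1⟩, hr0.le, hr2.le⟩, hy⟩, rfl⟩
  have hsub : K ∪ Φ ⊆ Metric.cthickening (r * R) K := by
    refine union_subset (Metric.self_subset_cthickening _) ?_
    rintro _ ⟨x, hx, z, hz, -, rfl⟩
    refine Metric.mem_cthickening_of_dist_le _ x _ _ (hK'sub hx).1 ?_
    have h1 : (1 - r) • x + r • z - x = r • (z - x) := by module
    rw [dist_eq_norm, h1, norm_smul, Real.norm_of_nonneg hr0.le]
    exact mul_le_mul_of_nonneg_left (hR x (hK'sub hx).1 z hz) hr0.le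
  have h1 := measure_mono (μ := volume) hsub
  rw [measure_union' hdisj hK.measurableSet] at h1
  exact absurd (h1.trans_lt hthick) (not_lt.2 (by gcongr))

/-! ### Compact sets inside measurable images. -/

/-- A finer Polish topology with the same Borel sets makes `g` continuous; inner regularity is then
applied in that topology. -/
theorem Measurable.exists_isCompact_image {α E : Type*} [t : TopologicalSpace α] [hp : PolishSpace α]
    [mα : MeasurableSpace α] [hα : BorelSpace α] [TopologicalSpace E] [SecondCountableTopology E]
    [MeasurableSpace E] [OpensMeasurableSpace E] {ν : Measure α} [IsFiniteMeasure ν] {g : α → E}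
    (hg : Measurable g) {B : Set α} (hB : MeasurableSet B) (hpos : ν B ≠ 0) :
    ∃ K ⊆ B, MeasurableSet K ∧ ν K ≠ 0 ∧ IsCompact (g '' K) := by
  obtain ⟨t', hle, hgc, hpol⟩ := hg.exists_continuous
  have hborel : @BorelSpace α t' _ := by
    refine @BorelSpace.mk α t' _ (hα.measurable_eq.trans ?_)
    exact (borel_eq_borel_of_le hpol hp hle).symm
  obtain ⟨K, hKB, hK, hKpos⟩ := @MeasurableSet.exists_lt_isCompact α _ ν t' _ B hB 0
    (pos_iff_ne_zero.2 hpos)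
  exact ⟨K, hKB, @IsCompact.measurableSet α K t' _ _ _ hK, hKpos.ne',
    @IsCompact.image α E t' _ K g hK hgc⟩

/-- The image of a nonnull measurable subset of a measure-interval under a measurable mapping
contains a compact set whose preimage is nonnull. -/
theorem IsMeasureInterval.exists_isCompact_subset_image {X E : Type*} [MeasurableSpace X]
    {μ : Measure X} (hX : IsMeasureInterval μ) [TopologicalSpace E] [SecondCountableTopology E]
    [T2Space E] [MeasurableSpace E] [BorelSpace E]
    {s : X → E} (hs : Measurable s) {A : Set X} (hA : MeasurableSet A) (hpos : μ A ≠ 0) :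
    ∃ K, IsCompact K ∧ K ⊆ s '' A ∧ μ (s ⁻¹' K) ≠ 0 := by
  obtain ⟨τ, hτ, hτpre, L, M, hL, -, hbij, hτimg⟩ := hX.exists_transformation
  have := hX.complete
  have hLm : MeasurableSet L := this.out' L hL
  have hne : Nonempty X := by
    by_contra h
    rw [not_nonempty_iff] at h
    exact hpos (by simp [A.eq_empty_of_isEmpty])
  let A' := A \ L
  have hA' : MeasurableSet A' := hA.diff hLm
  have hA'L : A' ⊆ Lᶜ := fun x hx => hx.2
  let T := τ '' A'
  have hT := hτimg A' hA'L hA'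
  have hTpos : volume T ≠ 0 := by
    rw [hT.2, measure_sdiff_null hL]
    exact hpos
  have hTfin : volume T ≠ ⊤ := by
    have hTI : T ⊆ Icc (0 : ℝ) (μ univ).toReal := by
      rintro _ ⟨x, -, rfl⟩
      exact hτ x
    exact ((measure_mono hTI).trans_lt measure_Icc_lt_top).ne
  -- `s` transported to the interval. It is only Lebesgue measurable on `T`, so a Borel version is
  -- used, on a Borel set `B ⊆ T` of full measure where the two agree.
  let g : ℝ → E := s ∘ Function.invFunOn τ Lᶜ
  have hgτ : ∀ x ∈ Lᶜ, g (τ x) = s x := fun x hx =>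
    congrArg s (hbij.injOn.leftInvOn_invFunOn hx)
  let m : Measure ℝ := volume.restrict T
  have : IsFiniteMeasure m := ⟨by simpa [m] using hTfin.lt_top⟩
  have hg : AEMeasurable g m := by
    refine NullMeasurable.aemeasurable fun B hB => ?_
    rw [nullMeasurableSet_restrict hT.1]
    have : g ⁻¹' B ∩ T = τ '' (A' ∩ s ⁻¹' B) := by
      ext y
      constructor
      · rintro ⟨hy, x, hx, rfl⟩
        exact ⟨x, ⟨hx, by simpa [hgτ x (hA'L hx)] using hy⟩, rfl⟩
      · rintro ⟨x, ⟨hx, hxB⟩, rfl⟩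
        exact ⟨by simpa [hgτ x (hA'L hx)] using hxB, x, hx, rfl⟩
    rw [this]
    exact (hτimg _ (inter_subset_left.trans hA'L) (hA'.inter (hs hB))).1
  have hae : m {y | ¬ (y ∈ T ∧ g y = hg.mk g y)} = 0 :=
    ae_iff.1 ((ae_restrict_mem₀ hT.1).and hg.ae_eq_mk)
  let B := (toMeasurable m {y | ¬ (y ∈ T ∧ g y = hg.mk g y)})ᶜ
  have hBm : MeasurableSet B := (measurableSet_toMeasurable _ _).compl
  have hB : ∀ y ∈ B, y ∈ T ∧ g y = hg.mk g y := fun y hy => by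
    by_contra h
    exact hy (subset_toMeasurable _ _ h)
  have hBpos : m B ≠ 0 := by
    rw [measure_compl (measurableSet_toMeasurable _ _) (measure_ne_top _ _), measure_toMeasurable,
      hae, tsub_zero]
    simpa [m] using hTpos
  obtain ⟨K, hKB, hKm, hKpos, hKc⟩ := hg.measurable_mk.exists_isCompact_image hBm hBpos
  have hKT : K ⊆ T := fun y hy => (hB y (hKB hy)).1
  refine ⟨_, hKc, ?_, fun h0 => ?_⟩
  · rintro _ ⟨y, hy, rfl⟩
    obtain ⟨x, hx, rfl⟩ := hKT hy
    rw [← (hB _ (hKB hy)).2, hgτ x (hA'L hx)]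
    exact ⟨x, hx.1, rfl⟩
  · have hKI : K ⊆ Icc (0 : ℝ) (μ univ).toReal := by
      intro y hy
      obtain ⟨x, -, rfl⟩ := hKT hy
      exact hτ x
    have h1 := (hτpre K hKI hKm.nullMeasurableSet).2
    have h2 : τ ⁻¹' K ⊆ s ⁻¹' (hg.mk g '' K) ∪ L := by
      intro x hx
      by_cases hxL : x ∈ L
      · exact Or.inr hxL
      · refine Or.inl ⟨τ x, hx, ?_⟩
        rw [← (hB _ (hKB hx)).2, hgτ x hxL]
    have h3 : μ (τ ⁻¹' K) = 0 := measure_mono_null h2 (measure_union_null h0 hL)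
    rw [h1] at h3
    exact hKpos (Measure.absolutelyContinuous_of_le Measure.restrict_le_self h3)

/-! ### Level sets of the gradient and rational hyperplanes. -/

/-- Only countably many level sets of a finite measure can be nonnull. -/
theorem nullMeasurableSet_nullLevelPart {α β : Type*} [MeasurableSpace α] [MeasurableSpace β]
    [MeasurableSingletonClass β] {ν : Measure α} [IsFiniteMeasure ν] {f : α → β}
    (hf : AEMeasurable f ν) : NullMeasurableSet (nullLevelPart ν f) ν := by
  have hcount : {b : β | 0 < ν (f ⁻¹' {b})}.Countable :=
    Measure.countable_meas_pos_of_disjoint_iUnion₀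
      (fun b => hf.nullMeasurable (measurableSet_singleton b))
      (fun b c hbc => (Disjoint.preimage f (disjoint_singleton.2 hbc)).aedisjoint)
  have : nullLevelPart ν f = (f ⁻¹' {b : β | 0 < ν (f ⁻¹' {b})})ᶜ := by
    ext x
    simp [nullLevelPart]
  rw [this]
  exact (hf.nullMeasurable hcount.measurableSet).compl

/-- The tangent at `x` bounds `f` from below on the segment; the chord bounds it from above, and the
tangent at `x'` shows that the chord is no steeper. -/
theorem ConvexOn.eq_add_inner_of_gradient_eq {E : Type*} [NormedAddCommGroup E]
    [InnerProductSpace ℝ E] [CompleteSpace E] {Ω : Set E} {f : E → ℝ} (hf : ConvexOn ℝ Ω f)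
    {x x' p : E} (hx : x ∈ Ω) (hx' : x' ∈ Ω) (hp : HasGradientAt f p x)
    (hp' : HasGradientAt f p x') {r : ℝ} (hr0 : 0 ≤ r) (hr1 : r ≤ 1) :
    f ((1 - r) • x + r • x') = f x + r * inner ℝ p (x' - x) := by
  have h1 := hf.add_inner_le_of_hasGradientAt hx' hx hp'
  have h3 := hf.2 hx hx' (sub_nonneg.2 hr1) hr0 (by ring)
  have h4 := hf.add_inner_le_of_hasGradientAt hx
    (hf.1 hx hx' (sub_nonneg.2 hr1) hr0 (by ring)) hp
  have h5 : (1 - r) • x + r • x' - x = r • (x' - x) := by module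
  have h6 : inner ℝ p (x - x') = - inner ℝ p (x' - x) := by rw [← inner_neg_right, neg_sub]
  rw [h5, real_inner_smul_right] at h4
  rw [h6] at h1
  simp only [smul_eq_mul] at h3
  refine le_antisymm (h3.trans ?_) h4
  nlinarith

/-- Points of `C` from which a convex function is affine towards some point of `C'` on the
coordinate hyperplane at height `q`. -/
def affineTowards {n : ℕ} (f : EuclideanSpace ℝ (Fin n) → ℝ)
    (C C' : Set (EuclideanSpace ℝ (Fin n))) (i : Fin n) (q : ℝ) :
    Set (EuclideanSpace ℝ (Fin n)) :=
  {x ∈ C | x i ≠ q ∧ ∃ z ∈ C', z i = q ∧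
    f ((1 - (1 / 2 : ℝ)) • x + (1 / 2 : ℝ) • z) = (1 - 1 / 2) * f x + 1 / 2 * f z}

theorem measurableSet_affineTowards {n : ℕ} {f : EuclideanSpace ℝ (Fin n) → ℝ}
    {Ω C C' : Set (EuclideanSpace ℝ (Fin n))} (hΩ : Convex ℝ Ω) (hf : ContinuousOn f Ω)
    (hC : IsCompact C) (hC' : IsCompact C') (hCΩ : C ⊆ Ω) (hCΩ' : C' ⊆ Ω) (i : Fin n) (q : ℝ) :
    MeasurableSet (affineTowards f C C' i q) := by
  have hi : Continuous fun z : EuclideanSpace ℝ (Fin n) => z i := by fun_prop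
  let S : Set (EuclideanSpace ℝ (Fin n) × EuclideanSpace ℝ (Fin n)) := {p ∈ C ×ˢ C' |
    f ((1 - (1 / 2 : ℝ)) • p.1 + (1 / 2 : ℝ) • p.2) = (1 - 1 / 2) * f p.1 + 1 / 2 * f p.2}
  have hS : IsCompact S := by
    refine (hC.prod hC').of_isClosed_subset ?_ (sep_subset _ _)
    refine IsClosed.isClosed_eq (hC.prod hC').isClosed ?_ ?_
    · refine hf.comp (by fun_prop) fun p hp => ?_
      exact hΩ (hCΩ hp.1) (hCΩ' hp.2) (by norm_num) (by norm_num) (by norm_num)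
    · exact ((hf.comp continuousOn_fst fun p hp => hCΩ hp.1).const_smul (1 - 1 / 2 : ℝ)).add
        ((hf.comp continuousOn_snd fun p hp => hCΩ' hp.2).const_smul (1 / 2 : ℝ))
  -- The closed conditions on pairs project to a compact set; the open condition `x i ≠ q` does not
  -- involve `z` and stays outside the projection.
  have : affineTowards f C C' i q =
      Prod.fst '' (S ∩ {p | p.2 i = q}) ∩ {x | x i ≠ q} := by
    ext x
    constructor
    · rintro ⟨hx, hxq, z, hz, hzq, h⟩
      exact ⟨⟨(x, z), ⟨⟨⟨hx, hz⟩, h⟩, hzq⟩, rfl⟩, hxq⟩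
    · rintro ⟨⟨⟨x', z⟩, ⟨⟨⟨hx, hz⟩, h⟩, hzq⟩, rfl⟩, hxq⟩
      exact ⟨hx, hxq, z, hz, hzq, h⟩
  rw [this]
  refine MeasurableSet.inter (IsCompact.measurableSet ?_) ?_
  · exact (hS.inter_right (isClosed_eq (hi.comp continuous_snd) continuous_const)).image
      continuous_fst
  · exact (isOpen_ne_fun hi continuous_const).measurableSet

/-- If two points share their gradient, one is joined to a rational hyperplane section by a segment
on which the function is affine. -/
theorem ConvexOn.mem_affineTowards_of_gradient_eq {n : ℕ} {f : EuclideanSpace ℝ (Fin n) → ℝ}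
    {Ω : Set (EuclideanSpace ℝ (Fin n))} (hf : ConvexOn ℝ Ω f)
    {x x' p : EuclideanSpace ℝ (Fin n)} (hx : x ∈ Ω) (hx' : x' ∈ Ω) (hne : x ≠ x')
    (hp : HasGradientAt f p x) (hp' : HasGradientAt f p x') :
    ∃ (i : Fin n) (q : ℚ), x ∈ affineTowards f Ω Ω i q := by
  obtain ⟨i, hi⟩ : ∃ i, x i ≠ x' i := by
    by_contra! h
    exact hne (PiLp.ext h)
  obtain ⟨q, t, ht0, ht1, hq⟩ : ∃ (q : ℚ) (t : ℝ), 0 < t ∧ t < 1 ∧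
      (1 - t) * x i + t * x' i = q := by
    rcases lt_or_gt_of_ne hi with h | h
    · obtain ⟨q, hq1, hq2⟩ := exists_rat_btwn h
      have hd : 0 < x' i - x i := sub_pos.2 h
      refine ⟨q, (q - x i) / (x' i - x i), div_pos (by linarith) hd,
        (div_lt_one hd).2 (by linarith), ?_⟩
      field_simp
      ring
    · obtain ⟨q, hq1, hq2⟩ := exists_rat_btwn h
      have hd : 0 < x i - x' i := sub_pos.2 h
      refine ⟨q, (x i - q) / (x i - x' i), div_pos (by linarith) hd,
        (div_lt_one hd).2 (by linarith), ?_⟩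
      field_simp
      ring
  refine ⟨i, q, hx, fun h => ?_, (1 - t) • x + t • x',
    hf.1 hx hx' (by linarith) ht0.le (by ring), by simpa using hq, ?_⟩
  · rw [← hq] at h
    have : t * (x i - x' i) = 0 := by linarith
    rcases mul_eq_zero.1 this with h1 | h1
    · exact ht0.ne' h1
    · exact hi (sub_eq_zero.1 h1)
  -- The midpoint of `x` and the hyperplane point has parameter `t / 2` on the segment from `x` to
  -- `x'`.
  · have h1 : (1 - (1 / 2 : ℝ)) • x + (1 / 2 : ℝ) • ((1 - t) • x + t • x') =
        (1 - t / 2) • x + (t / 2) • x' := by module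
    rw [h1, hf.eq_add_inner_of_gradient_eq hx hx' hp hp' (by linarith) (by linarith),
      hf.eq_add_inner_of_gradient_eq hx hx' hp hp' ht0.le ht1.le]
    ring

theorem IsOpen.exists_isCompact_iUnion_eq {n : ℕ} {Ω : Set (EuclideanSpace ℝ (Fin n))}
    (hΩ : IsOpen Ω) : ∃ C : ℕ → Set (EuclideanSpace ℝ (Fin n)),
      (∀ k, IsCompact (C k)) ∧ ⋃ k, C k = Ω := by
  have : LocallyCompactSpace Ω := hΩ.locallyCompactSpace
  exact isSigmaCompact_iff_sigmaCompactSpace.2 inferInstance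

/-- If each point of a nonnull subset of an open set `Ω` has an affine segment to a rational
hyperplane section of `Ω`, then compact sets can be chosen that serve a nonnull part of it. -/
theorem IsOpen.exists_nonnull_inter_affineTowards {n : ℕ}
    {ν : Measure (EuclideanSpace ℝ (Fin n))} {f : EuclideanSpace ℝ (Fin n) → ℝ}
    {Ω D : Set (EuclideanSpace ℝ (Fin n))} (hΩ : IsOpen Ω)
    (hD : ∀ x ∈ D, ∃ (i : Fin n) (q : ℚ), x ∈ affineTowards f Ω Ω i q) (hpos : ν D ≠ 0) :
    ∃ C C' : Set (EuclideanSpace ℝ (Fin n)), IsCompact C ∧ IsCompact C' ∧ C ⊆ Ω ∧ C' ⊆ Ω ∧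
      ∃ (i : Fin n) (q : ℝ), ν (D ∩ affineTowards f C C' i q) ≠ 0 := by
  obtain ⟨C, hC, hCΩ⟩ := hΩ.exists_isCompact_iUnion_eq
  have hsub : ∀ k, C k ⊆ Ω := fun k => hCΩ ▸ subset_iUnion C k
  by_contra! h
  refine hpos (measure_mono_null (t := ⋃ a : ℕ × ℕ × Fin n × ℚ,
    D ∩ affineTowards f (C a.1) (C a.2.1) a.2.2.1 a.2.2.2) ?_ (measure_iUnion_null fun a =>
      h _ _ (hC _) (hC _) (hsub _) (hsub _) _ _))
  intro x hx
  obtain ⟨i, q, hxΩ, hxq, z, hz, hzq, heq⟩ := hD x hx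
  rw [← hCΩ] at hxΩ hz
  obtain ⟨k, hk⟩ := mem_iUnion.1 hxΩ
  obtain ⟨k', hk'⟩ := mem_iUnion.1 hz
  exact mem_iUnion.2 ⟨(k, k', i, q), hx, hk, hxq, z, hk', hzq, heq⟩

/-! ### Almost injectivity and the conclusion. -/

/-- If `w ∘ s` is almost countable to one for a measure-preserving `s` from a measure-interval, and
`w` is a gradient of a convex function, then `w` is almost injective off its nonnull level sets. -/
theorem IsConvexGradientOn.almostInjectiveOn {n : ℕ} {Y : Set (EuclideanSpace ℝ (Fin n))}
    {ν : Measure (EuclideanSpace ℝ (Fin n))} (hν : ν = volume.restrict Y) [IsFiniteMeasure ν]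
    {w : EuclideanSpace ℝ (Fin n) → EuclideanSpace ℝ (Fin n)} (hw : IsConvexGradientOn w Y)
    (hwm : AEMeasurable w ν) {X : Type*} [MeasurableSpace X] {μ : Measure X}
    (hX : IsMeasureInterval μ) {u : X → EuclideanSpace ℝ (Fin n)}
    (hlaw : ∀ b, μ (u ⁻¹' {b}) = ν (w ⁻¹' {b}))
    (hcount : AlmostCountableToOneOn μ u (nullLevelPart μ u))
    {s : X → EuclideanSpace ℝ (Fin n)} (hs : MeasurePreserving s μ ν) (hus : u =ᵐ[μ] w ∘ s) :
    AlmostInjectiveOn ν w (nullLevelPart ν w) := by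
  obtain ⟨ψ, hψ, hψw⟩ := hw
  rw [← hν] at hψw
  let f : EuclideanSpace ℝ (Fin n) → ℝ := fun y => (ψ y).toReal
  let Ω : Set (EuclideanSpace ℝ (Fin n)) := interior {y | ψ y ≠ ⊤}
  have hΩ : IsOpen Ω := isOpen_interior
  have hf : ConvexOn ℝ Ω f := hψ.convexOn_toReal.subset interior_subset
    hψ.convexOn_toReal.1.interior
  let G := {y | HasExtGradientAt ψ (w y) y}
  have hGΩ : G ⊆ Ω := fun y hy => mem_interior_iff_mem_nhds.2 (hy.1.mono fun z hz => hz.1)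
  let Y₀ := nullLevelPart ν w
  have hY₀ : NullMeasurableSet Y₀ ν := nullMeasurableSet_nullLevelPart hwm
  have hG : NullMeasurableSet G ν :=
    NullMeasurableSet.of_compl (NullMeasurableSet.of_null (ae_iff.1 hψw))
  let D := {x ∈ Y₀ ∩ G | ∃ x' ∈ Y₀ ∩ G, x ≠ x' ∧ w x = w x'}
  have hDnull : ν D = 0 := by
    by_contra hpos
    obtain ⟨C, C', hC, hC', hCΩ, hCΩ', i, q, hP⟩ := hΩ.exists_nonnull_inter_affineTowards (f := f)
      (D := D) (fun x hx => by
        obtain ⟨x', hx', hne, hxx⟩ := hx.2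
        exact hf.mem_affineTowards_of_gradient_eq (hGΩ hx.1.2) (hGΩ hx'.2) hne hx.1.2.2
          (hxx ▸ hx'.2.2)) hpos
    let P := affineTowards f C C' i q
    have hPm : MeasurableSet P :=
      measurableSet_affineTowards hf.1 (hf.continuousOn hΩ) hC hC' hCΩ hCΩ' i q
    -- `D` is not known to be measurable; `Y₀ ∩ G ∩ P` contains `D ∩ P` and is null-measurable.
    have hQm : NullMeasurableSet (Y₀ ∩ G ∩ P) ν := (hY₀.inter hG).inter hPm.nullMeasurableSet
    have hQ : ν (Y₀ ∩ G ∩ P) ≠ 0 := fun h =>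
      hP (measure_mono_null (inter_subset_inter_left _ (sep_subset _ _)) h)
    obtain ⟨U, hU, hUnull, hUc⟩ := hcount
    let A := s ⁻¹' (Y₀ ∩ G ∩ P) ∩ {x | u x = w (s x)}
    have hAm : NullMeasurableSet A μ :=
      (hQm.preimage hs.quasiMeasurePreserving).inter
        (NullMeasurableSet.of_compl (NullMeasurableSet.of_null (ae_iff.1 hus)))
    have hApos : μ A ≠ 0 := by
      have hus' : μ {x | u x = w (s x)}ᶜ = 0 := ae_iff.1 hus
      rw [measure_inter_conull hus', hs.measure_preimage hQm]
      exact hQ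
    have hAX : A \ U ⊆ nullLevelPart μ u \ U := by
      refine sdiff_subset_sdiff_left ?_
      rintro x ⟨hx, hux⟩
      have h1 : ν (w ⁻¹' {w (s x)}) = 0 := hx.1.1
      change μ (u ⁻¹' {u x}) = 0
      rw [hlaw, show u x = w (s x) from hux, h1]
    have hAU : (A ∩ U : Set X) =ᵐ[μ] A := by
      rw [← Set.sdiff_sdiff_right_self, sdiff_ae_eq_self]
      exact measure_mono_null (inter_subset_right.trans hAX) hUnull
    obtain ⟨A', hA'sub, hA'm, hA'eq⟩ := (hAm.congr hAU.symm).exists_measurable_subset_ae_eq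
    obtain ⟨K, hK, hKs, hKpos⟩ := hX.exists_isCompact_subset_image hs.measurable hA'm
      (by rw [measure_congr (hA'eq.trans hAU)]; exact hApos)
    have hKQ : K ⊆ Y₀ ∩ G ∩ P := by
      intro y hy
      obtain ⟨x, hx, rfl⟩ := hKs hy
      exact (hA'sub hx).1.1
    have hi : Continuous fun z : EuclideanSpace ℝ (Fin n) => z i := by fun_prop
    have hvol : volume K = 0 := by
      refine hf.volume_eq_zero_of_countable_gradient_fibers (v := w) (Z := C' ∩ {z | z i = q})
        hΩ hK (fun y hy => hGΩ (hKQ hy).1.2) (hC'.inter_right (isClosed_eq hi continuous_const))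
        (inter_subset_left.trans hCΩ') (fun y hy => (hKQ hy).1.2.2) (fun b => ?_)
        (EuclideanSpace.proj i) q (fun y hy => (hKQ hy).2.2.1) (fun z hz => hz.2)
        (s := 1 / 2) (by norm_num) (by norm_num) (fun y hy => ?_)
      -- Every point of `K` is `s x` for some `x ∈ U` with `u x = w (s x)`, so fibres of `w` in `K`
      -- are covered by `s`-images of countable fibres of `u`.
      · refine ((hUc b).image s).mono ?_
        rintro y ⟨hy, hyb⟩
        obtain ⟨x, hx, rfl⟩ := hKs hy
        have h1 : u x = w (s x) := (hA'sub hx).1.2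
        exact ⟨x, ⟨(hA'sub hx).2, h1.trans hyb⟩, rfl⟩
      · obtain ⟨z, hz, hzq, h⟩ := (hKQ hy).2.2.2
        exact ⟨z, ⟨hz, hzq⟩, h⟩
    rw [hs.measure_preimage hK.measurableSet.nullMeasurableSet, hν] at hKpos
    exact hKpos (Measure.absolutelyContinuous_of_le Measure.restrict_le_self hvol)
  refine ⟨(Y₀ ∩ G) \ D, fun x hx => hx.1.1, ?_, fun x hx x' hx' hxx => ?_⟩
  · refine measure_mono_null (t := Gᶜ ∪ D) ?_ (measure_union_null (ae_iff.1 hψw) hDnull)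
    intro x hx
    by_contra h
    rw [mem_union, not_or, notMem_compl_iff] at h
    exact hx.2 ⟨⟨hx.1, h.1⟩, h.2⟩
  · by_contra hne
    exact hx.2 ⟨hx.1, x', hx'.1, hne, hxx⟩

theorem theorem1 {n : ℕ} (Y : Set (EuclideanSpace ℝ (Fin n)))
    (hYmeas : NullMeasurableSet Y volume) (hYpos : 0 < volume Y) (hYfin : volume Y < ⊤)
    (uSharp : EuclideanSpace ℝ (Fin n) → EuclideanSpace ℝ (Fin n))
    (huSharp_int : Integrable uSharp (volume.restrict Y))
    (huSharp_grad : IsConvexGradientOn uSharp Y)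
    (huSharp_inj : ¬ AlmostInjectiveOn (volume.restrict Y) uSharp
      (nullLevelPart (volume.restrict Y) uSharp))
    {X : Type*} [MeasurableSpace X] (μ : Measure X) (hX : IsMeasureInterval μ)
    (hXY : μ univ = volume Y)
    (u : X → EuclideanSpace ℝ (Fin n))
    (hu : IsRearrangement u μ uSharp (volume.restrict Y))
    (hu_count : AlmostCountableToOneOn μ u (nullLevelPart μ u)) :
    ¬ HasPolarFactorisation μ u Y := by
  rintro ⟨v, ⟨hv, hv_grad⟩, s, -, hs, hus⟩
  have hfin : IsFiniteMeasure ((volume : Measure (EuclideanSpace ℝ (Fin n))).restrict Y) :=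
    ⟨by simpa using hYfin⟩
  have hmw := huSharp_int.aestronglyMeasurable.aemeasurable
  have hmv := hv.2.1.aestronglyMeasurable.aemeasurable
  have hvw : v =ᵐ[volume.restrict Y] uSharp := by
    refine ae_eq_of_isConvexGradientOn_of_map_eq hv_grad huSharp_grad hmv hmw ?_
    refine Measure.ext fun B hB => ?_
    rw [Measure.map_apply_of_aemeasurable hmv hB, Measure.map_apply_of_aemeasurable hmw hB,
      ← hv.2.2 B hB, ← hu.2.2 B hB]
  exact huSharp_inj (huSharp_grad.almostInjectiveOn rfl hmw hX
    (fun b => hu.2.2 _ (measurableSet_singleton b))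
    hu_count hs (hus.trans (hs.quasiMeasurePreserving.ae_eq_comp hvw)))
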